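/- Let $\operatorname{erf}(z)=\frac{2}{\sqrt\pi}\int_0^z e^{-t^2}\,dt$ be the error function of a complex variable, and let $$I_\mu(z)=\Big(\frac z2\Big)^{\mu}\sum_{k=0}^\infty\frac{(z^2/4)^k}{k!\,\Gamma(\mu+k+1)}$$ be the modified Bessel function of the first kind. Then for every $w\in\mathbb{C}$ and every $\theta\in\mathbb{R}$, $$\operatorname{erf}\big(w\cos(\theta/2)\big)=2\,e^{-\frac12 w^2\cos\theta}\sum_{m=0}^\infty I_{m+\frac12}\big(w^2/2\big)\cos\big((m+\tfrac12)\theta\big),$$ where the series converges absolutely. Here the branch of $I_{m+\frac12}$ at $w^2/2$ is the one determined by $\arg(w^2/2)=2\arg w$. Precisely: 1. if $w=0$ or $-\frac{\pi}{2}<\arg w\le\frac{\pi}{2}$ (that is, $w$ is the principal square root of $w^2$), the formula holds with the principal branch of $I_{m+\frac12}$; 2. for every $w\neq0$ and every $\omega\in\mathbb{C}$ with $e^\omega=w$, the formula holds when $I_{m+\frac12}(w^2/2)$ denotes the value of the (multivalued) analytic continuation of $I_{m+\frac12}$ at the point of the Riemann surface of the logarithm whose logarithm is $2\omega-\log 2$,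 that is, when $(z/2)^{m+\frac12}$ at $z=w^2/2$ is read as $\exp\big((m+\tfrac12)(2\omega-2\log 2)\big)$. -/

import Mathlib

noncomputable section

/-- The error function `erf z = (2 / √π) ∫₀^z exp (-t²) dt` of a complex variable; the integrand is
entire, and the integral is taken along the segment `t = s z`, `0 ≤ s ≤ 1`. -/
def cerf (z : ℂ) : ℂ :=
  2 / (Real.sqrt Real.pi : ℂ) * ∫ s in (0 : ℝ)..1, z * Complex.exp (-((s : ℂ) * z) ^ 2)

/-- The single-valued factor `∑ₖ (z² / 4)ᵏ / (k! Γ(μ + k + 1))` of the modified Bessel function.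
The summand is `0` where `μ + k + 1` is a pole of `Γ`, since `Complex.Gamma` is `0` there. -/
def besselISeries (μ z : ℂ) : ℂ :=
  ∑' k : ℕ, (z ^ 2 / 4) ^ k / ((k.factorial : ℂ) * Complex.Gamma (μ + k + 1))

/-- The principal branch of the modified Bessel function of the first kind,
`I_μ(z) = (z / 2)^μ ∑ₖ (z² / 4)ᵏ / (k! Γ(μ + k + 1))`, with the principal power. -/
def besselI (μ z : ℂ) : ℂ :=
  (z / 2) ^ μ * besselISeries μ z

/-- The multivalued modified Bessel function `I_μ`, as a function on the Riemann surface of the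
logarithm: the value of `I_μ` at the point over `exp ζ` whose logarithm is `ζ`, that is, the
analytic continuation of the principal branch to the phase `Im ζ`. -/
def besselILift (μ ζ : ℂ) : ℂ :=
  Complex.exp (μ * (ζ - Complex.log 2)) * besselISeries μ (Complex.exp ζ)

end

/-! Put `x = w / 2`, so the Bessel argument is `2 x ^ 2`, and write `J_m = x I_{m-1/2}(2 x ^ 2)`
(`besselSum`), `c_m = cos((m + 1/2) θ)`, `F = ∑ c_m I_{m+1/2}(2 x ^ 2)`. All are entire in `x`, so
branches matter only at the very end. The Bessel derivative formula gives `F' = 2 ∑ c_m (J_m +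
J_{m+2})`. Since `c_{m+1} + c_{m-1} = 2 cos θ c_m`, this sum collapses to `F' = 4 cos θ x F + 2
cos(θ/2) (J_0 - J_1)`, and `J_0 - J_1 = exp(-2 x ^ 2) / √π`. With the integrating factor `exp(-2 cos
θ x ^ 2)` and `1 + cos θ = 2 cos²(θ/2)`, the right side becomes the derivative of `erf(2 x cos(θ/2))
/ 2`; both sides vanish at `0`. -/

/-- The value `1 / Γ(n + 1/2)`. -/
noncomputable def halfGammaInv (n : ℕ) : ℂ := (Complex.Gamma ((n : ℂ) + 1 / 2))⁻¹

theorem natCast_add_half_ne_zero (n : ℕ) : (n : ℂ) + 1 / 2 ≠ 0 := by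
  intro h
  have := congrArg Complex.re h
  simp at this
  have h0 : (0 : ℝ) ≤ n := n.cast_nonneg
  linarith

theorem halfGammaInv_zero : halfGammaInv 0 = ((Real.sqrt Real.pi : ℝ) : ℂ)⁻¹ := by
  rw [← Real.Gamma_one_half_eq, ← Complex.Gamma_ofReal, halfGammaInv]
  norm_num

theorem halfGammaInv_succ (n : ℕ) :
    ((n : ℂ) + 1 / 2) * halfGammaInv (n + 1) = halfGammaInv n := by
  have h := natCast_add_half_ne_zero n
  unfold halfGammaInv
  have e : ((n + 1 : ℕ) : ℂ) + 1 / 2 = ((n : ℂ) + 1 / 2) + 1 := by push_cast; ring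
  rw [e, Complex.Gamma_add_one _ h, mul_inv, ← mul_assoc, mul_inv_cancel₀ h, one_mul]

theorem norm_halfGammaInv_succ_le (n : ℕ) :
    ‖halfGammaInv (n + 1)‖ ≤ 2 / (n + 1) * ‖halfGammaInv n‖ := by
  have e : ‖(n : ℂ) + 1 / 2‖ = (n : ℝ) + 1 / 2 := by
    have : (n : ℂ) + 1 / 2 = (((n : ℝ) + 1 / 2 : ℝ) : ℂ) := by push_cast; ring
    rw [this, Complex.norm_real, Real.norm_of_nonneg (by positivity)]
  rw [← halfGammaInv_succ n, norm_mul, e, ← mul_assoc]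
  refine le_mul_of_one_le_left (norm_nonneg _) ?_
  rw [div_mul_eq_mul_div, one_le_div (by positivity)]
  linarith [n.cast_nonneg (α := ℝ)]

theorem norm_halfGammaInv_le (n : ℕ) : ‖halfGammaInv n‖ ≤ 2 ^ n / n.factorial := by
  induction n with
  | zero =>
    rw [halfGammaInv_zero, norm_inv, Complex.norm_real, Real.norm_of_nonneg (Real.sqrt_nonneg _)]
    simp only [pow_zero, Nat.factorial_zero, Nat.cast_one, div_one]
    refine inv_le_one_of_one_le₀ (Real.one_le_sqrt.mpr ?_)
    linarith [Real.pi_gt_three]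
  | succ n ih =>
    refine (norm_halfGammaInv_succ_le n).trans
      ((mul_le_mul_of_nonneg_left ih (by positivity)).trans (le_of_eq ?_))
    rw [Nat.factorial_succ]
    push_cast
    field_simp
    ring

/-- An instance of Legendre duplication; with `halfGammaInv_eq_odd` it identifies the series of
`J_0` and `J_1` with the two halves of an exponential series. -/
theorem halfGammaInv_eq_even (k : ℕ) : halfGammaInv k / k.factorial =
    4 ^ k / (2 * k).factorial * ((Real.sqrt Real.pi : ℝ) : ℂ)⁻¹ := by
  induction k with
  | zero => simp [halfGammaInv_zero]
  | succ k ih =>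
    have h1 := natCast_add_half_ne_zero k
    have h2 : (k : ℂ) + 1 ≠ 0 := Nat.cast_add_one_ne_zero k
    have h3 : (k.factorial : ℂ) ≠ 0 := Nat.cast_ne_zero.mpr k.factorial_ne_zero
    have h4 : ((2 * k).factorial : ℂ) ≠ 0 := Nat.cast_ne_zero.mpr (2 * k).factorial_ne_zero
    have h5 : 2 * (k : ℂ) + 1 ≠ 0 := by intro h; apply h1; linear_combination h / 2
    have hs : halfGammaInv (k + 1) = halfGammaInv k / ((k : ℂ) + 1 / 2) := by
      rw [← halfGammaInv_succ k, mul_div_cancel_left₀ _ h1]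
    have hk : halfGammaInv k = k.factorial * (4 ^ k / (2 * k).factorial *
        ((Real.sqrt Real.pi : ℝ) : ℂ)⁻¹) := by
      rw [← ih]; field_simp
    rw [hs, hk, show 2 * (k + 1) = 2 * k + 1 + 1 by ring, Nat.factorial_succ, Nat.factorial_succ,
      Nat.factorial_succ]
    push_cast
    have h6 : 2 * (k : ℂ) + 1 + 1 ≠ 0 := by intro h; apply h2; linear_combination h / 2
    rw [show (k : ℂ) + 1 / 2 = (2 * k + 1) / 2 by ring,
      show 2 * (k : ℂ) + 1 + 1 = 2 * (k + 1) by ring]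
    field_simp
    ring

theorem halfGammaInv_eq_odd (k : ℕ) : halfGammaInv (k + 1) / k.factorial =
    2 * 4 ^ k / (2 * k + 1).factorial * ((Real.sqrt Real.pi : ℝ) : ℂ)⁻¹ := by
  have h1 := natCast_add_half_ne_zero k
  have h5 : 2 * (k : ℂ) + 1 ≠ 0 := by intro h; apply h1; linear_combination h / 2
  have hs : halfGammaInv (k + 1) = halfGammaInv k / ((k : ℂ) + 1 / 2) := by
    rw [← halfGammaInv_succ k, mul_div_cancel_left₀ _ h1]
  rw [hs, div_right_comm, halfGammaInv_eq_even, Nat.factorial_succ]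
  push_cast
  rw [show (k : ℂ) + 1 / 2 = (2 * k + 1) / 2 by ring]
  have h4 : ((2 * k).factorial : ℂ) ≠ 0 := Nat.cast_ne_zero.mpr (2 * k).factorial_ne_zero
  field_simp

/-! ### Bessel series of half-integer order and their majorants -/

/-- The `(m, k)` term of the expansion of `x * I_{m - 1/2} (2 * x ^ 2)` in powers of `x`. -/
noncomputable def besselTerm (x : ℂ) (m k : ℕ) : ℂ :=
  x ^ (2 * m + 4 * k) * (halfGammaInv (m + k) / k.factorial)

/-- A summable majorant of `besselTerm` on the disc of radius `r`. -/
noncomputable def besselMajorant (r : ℝ) (p : ℕ × ℕ) : ℝ :=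
  (2 * r ^ 2) ^ p.1 / p.1.factorial * ((2 * r ^ 4) ^ p.2 / p.2.factorial)

theorem summable_besselMajorant (r : ℝ) : Summable (besselMajorant r) :=
  (Real.summable_pow_div_factorial (2 * r ^ 2)).mul_of_nonneg
    (Real.summable_pow_div_factorial (2 * r ^ 4)) (fun _ => by dsimp; positivity)
    (fun _ => by dsimp; positivity)

theorem norm_pow_mul_halfGammaInv_le {x : ℂ} {r : ℝ} (hx : ‖x‖ ≤ r) (m k : ℕ) :
    ‖x‖ ^ (2 * m + 4 * k) * (‖halfGammaInv (m + k)‖ / k.factorial) ≤ besselMajorant r (m, k) := by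
  have hr : 0 ≤ r := (norm_nonneg x).trans hx
  have h : ‖halfGammaInv (m + k)‖ ≤ 2 ^ (m + k) / m.factorial :=
    (norm_halfGammaInv_le _).trans (by gcongr; omega)
  calc ‖x‖ ^ (2 * m + 4 * k) * (‖halfGammaInv (m + k)‖ / k.factorial)
      ≤ r ^ (2 * m + 4 * k) * (2 ^ (m + k) / m.factorial / k.factorial) := by gcongr
    _ = besselMajorant r (m, k) := by
      simp only [besselMajorant, mul_pow, pow_add, pow_mul]
      field_simp

theorem norm_besselTerm_le {x : ℂ} {r : ℝ} (hx : ‖x‖ ≤ r) (m k : ℕ) :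
    ‖besselTerm x m k‖ ≤ besselMajorant r (m, k) := by
  rw [besselTerm, norm_mul, norm_div, norm_pow, Complex.norm_natCast]
  exact norm_pow_mul_halfGammaInv_le hx m k

theorem summable_mul_besselTerm (x : ℂ) {a : ℕ → ℂ} (ha : ∀ m, ‖a m‖ ≤ 1) :
    Summable (fun p : ℕ × ℕ => a p.1 * besselTerm x p.1 p.2) := by
  refine Summable.of_norm_bounded (summable_besselMajorant ‖x‖) fun p => ?_
  rw [norm_mul]
  exact (mul_le_of_le_one_left (norm_nonneg _) (ha _)).trans (norm_besselTerm_le le_rfl _ _)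

theorem summable_besselTerm (x : ℂ) (m : ℕ) : Summable (besselTerm x m) := by
  have h := (summable_mul_besselTerm x (a := fun _ => 1) (fun _ => by simp)).prod_factor m
  simpa using h

/-- The entire function `x * I_{m - 1/2} (2 * x ^ 2)`. -/
noncomputable def besselSum (x : ℂ) (m : ℕ) : ℂ := ∑' k, besselTerm x m k

theorem hasSum_besselTerm (x : ℂ) (m : ℕ) : HasSum (besselTerm x m) (besselSum x m) :=
  (summable_besselTerm x m).hasSum

theorem summable_mul_besselSum (x : ℂ) {a : ℕ → ℂ} (ha : ∀ m, ‖a m‖ ≤ 1) :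
    Summable (fun m => a m * besselSum x m) :=
  ((summable_mul_besselTerm x ha).hasSum.prod_fiberwise
    fun m => (hasSum_besselTerm x m).mul_left (a m)).summable

/-- `J_0` and `-J_1` are the even and odd parts of the series of `exp(-2 x ^ 2) / √π`. -/
theorem besselSum_zero_sub_one (x : ℂ) : besselSum x 0 - besselSum x 1 =
    Complex.exp (-2 * x ^ 2) * ((Real.sqrt Real.pi : ℝ) : ℂ)⁻¹ := by
  have he : HasSum (fun n : ℕ => (-2 * x ^ 2) ^ n / n.factorial *
      ((Real.sqrt Real.pi : ℝ) : ℂ)⁻¹) (besselSum x 0 + -besselSum x 1) := by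
    refine HasSum.even_add_odd ?_ ?_
    · refine (hasSum_besselTerm x 0).congr_fun fun k => ?_
      rw [besselTerm, zero_add, halfGammaInv_eq_even, pow_mul (-2 * x ^ 2)]
      rw [show (-2 * x ^ 2) ^ 2 = 4 * x ^ 4 by ring, mul_pow, ← pow_mul]
      ring
    · refine (hasSum_besselTerm x 1).neg.congr_fun fun k => ?_
      rw [besselTerm, add_comm 1 k, halfGammaInv_eq_odd, pow_succ (-2 * x ^ 2), pow_mul (-2 * x ^ 2)]
      rw [show (-2 * x ^ 2) ^ 2 = 4 * x ^ 4 by ring, mul_pow, ← pow_mul]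
      ring
  have hexp := (NormedSpace.expSeries_div_hasSum_exp (-2 * x ^ 2)).mul_right
    ((Real.sqrt Real.pi : ℝ) : ℂ)⁻¹
  rw [← Complex.exp_eq_exp_ℂ] at hexp
  rw [sub_eq_add_neg]
  exact he.unique hexp

/-! ### The weighted sum and its derivative -/

/-- The term of the expansion of `a m * I_{m + 1/2} (2 * x ^ 2)` in powers of `x`. -/
noncomputable def besselSeriesTerm (a : ℕ → ℂ) (p : ℕ × ℕ) (x : ℂ) : ℂ :=
  a p.1 * (halfGammaInv (p.1 + p.2 + 1) / p.2.factorial) * x ^ (2 * p.1 + 4 * p.2 + 1)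

theorem norm_besselSeriesTerm_le {a : ℕ → ℂ} (ha : ∀ m, ‖a m‖ ≤ 1) {x : ℂ} {r : ℝ} (hx : ‖x‖ ≤ r)
    (p : ℕ × ℕ) : ‖besselSeriesTerm a p x‖ ≤ 2 * r * besselMajorant r p := by
  obtain ⟨m, k⟩ := p
  have hr : 0 ≤ r := (norm_nonneg x).trans hx
  have h1 : ‖halfGammaInv (m + k + 1)‖ ≤ 2 * ‖halfGammaInv (m + k)‖ := by
    refine (norm_halfGammaInv_succ_le _).trans ?_
    gcongr
    exact div_le_self zero_le_two (by linarith [(m + k).cast_nonneg (α := ℝ)])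
  have h2 := norm_pow_mul_halfGammaInv_le hx m k
  rw [besselSeriesTerm, norm_mul, norm_mul, norm_div, norm_pow, Complex.norm_natCast]
  calc ‖a m‖ * (‖halfGammaInv (m + k + 1)‖ / k.factorial) * ‖x‖ ^ (2 * m + 4 * k + 1)
      ≤ 1 * (2 * ‖halfGammaInv (m + k)‖ / k.factorial) * (‖x‖ ^ (2 * m + 4 * k) * r) := by
        rw [pow_succ]
        gcongr
        exact ha m
    _ = 2 * r * (‖x‖ ^ (2 * m + 4 * k) * (‖halfGammaInv (m + k)‖ / k.factorial)) := by ring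
    _ ≤ _ := by gcongr

theorem summable_besselSeriesTerm {a : ℕ → ℂ} (ha : ∀ m, ‖a m‖ ≤ 1) (x : ℂ) :
    Summable (fun p => besselSeriesTerm a p x) :=
  Summable.of_norm_bounded ((summable_besselMajorant ‖x‖).mul_left (2 * ‖x‖))
    (norm_besselSeriesTerm_le ha le_rfl)

/-- The entire function `∑ a m * I_{m + 1/2} (2 * x ^ 2)`. -/
noncomputable def besselSeriesSum (a : ℕ → ℂ) (x : ℂ) : ℂ := ∑' p, besselSeriesTerm a p x

theorem hasSum_mul_besselSum_succ {a : ℕ → ℂ} (ha : ∀ m, ‖a m‖ ≤ 1) (x : ℂ) :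
    HasSum (fun m => a m * besselSum x (m + 1)) (x * besselSeriesSum a x) := by
  refine ((summable_besselSeriesTerm ha x).hasSum.mul_left x).prod_fiberwise fun m => ?_
  refine ((hasSum_besselTerm x (m + 1)).mul_left (a m)).congr_fun fun k => ?_
  simp only [besselTerm, besselSeriesTerm]
  rw [show m + 1 + k = m + k + 1 by ring]
  ring

/-- Split the exponent as `2m + 4k + 1 = 2 (m + k + 1/2) + 2k`: the first part lowers the Gamma
argument and gives `J_m`, the second cancels into `k!` and gives `J_{m+2}`. -/
theorem hasSum_deriv_besselSeriesTerm {a : ℕ → ℂ} (x : ℂ) (m : ℕ) :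
    HasSum (fun k => deriv (besselSeriesTerm a (m, k)) x)
      (2 * a m * (besselSum x m + besselSum x (m + 2))) := by
  let v : ℕ → ℂ := fun k => x ^ (2 * m + 4 * k) * (k * halfGammaInv (m + k + 1) / k.factorial)
  have hv : HasSum v (besselSum x (m + 2)) := by
    -- The factor `k` kills the term `k = 0`, so the index can be shifted by one.
    rw [← add_zero (besselSum x (m + 2)), ← (show ∑ i ∈ Finset.range 1, v i = 0 by simp [v]),
      ← hasSum_nat_add_iff]
    refine (hasSum_besselTerm x (m + 2)).congr_fun fun k => ?_
    have h1 : (k : ℂ) + 1 ≠ 0 := Nat.cast_add_one_ne_zero k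
    simp only [v, besselTerm]
    rw [Nat.factorial_succ, show m + (k + 1) + 1 = m + 2 + k by ring]
    push_cast
    rw [mul_div_mul_left _ _ h1]
    ring
  refine (((hasSum_besselTerm x m).add hv).mul_left (2 * a m)).congr_fun fun k => ?_
  have hd : HasDerivAt (besselSeriesTerm a (m, k)) _ x :=
    (hasDerivAt_pow (2 * m + 4 * k + 1) x).const_mul
      (a m * (halfGammaInv (m + k + 1) / k.factorial))
  rw [hd.deriv, besselTerm, ← halfGammaInv_succ (m + k)]
  simp only [v, add_tsub_cancel_right]
  push_cast
  ring

theorem hasDerivAt_besselSeriesSum {a : ℕ → ℂ} (ha : ∀ m, ‖a m‖ ≤ 1) (x : ℂ) :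
    HasDerivAt (besselSeriesSum a)
      (2 * (∑' m, a m * besselSum x m + ∑' m, a m * besselSum x (m + 2))) x := by
  set r := ‖x‖ + 1
  have hx : x ∈ Metric.ball (0 : ℂ) r := by simp [r]
  have hu := (summable_besselMajorant r).mul_left (2 * r)
  have hf : ∀ p, DifferentiableOn ℂ (besselSeriesTerm a p) (Metric.ball 0 r) := fun p => by
    unfold besselSeriesTerm
    fun_prop
  have hb : ∀ p, ∀ y ∈ Metric.ball (0 : ℂ) r,
      ‖besselSeriesTerm a p y‖ ≤ 2 * r * besselMajorant r p := fun p y hy =>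
    norm_besselSeriesTerm_le ha (by simpa using (Metric.mem_ball.mp hy).le) p
  have hd : DifferentiableAt ℂ (besselSeriesSum a) x :=
    (Complex.differentiableOn_tsum_of_summable_norm hu hf Metric.isOpen_ball hb).differentiableAt
      (Metric.isOpen_ball.mem_nhds hx)
  have hs : HasSum (fun p => deriv (besselSeriesTerm a p) x) (deriv (besselSeriesSum a) x) :=
    Complex.hasSum_deriv_of_summable_norm hu hf Metric.isOpen_ball hb hx
  have h1 := hs.prod_fiberwise (hasSum_deriv_besselSeriesTerm x)
  have h0 := (summable_mul_besselSum x ha).hasSum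
  -- The series of `a m * J_{m+2}` is obtained by subtracting that of `a m * J_m` from half the
  -- derivative.
  have h2 := ((h1.mul_left (1 / 2)).sub h0).congr_fun
    (g := fun m => a m * besselSum x (m + 2)) fun m => by ring
  rw [h2.tsum_eq]
  exact hd.hasDerivAt.congr_deriv (by ring)

/-! ### The differential equation and its integration -/

/-- The coefficients `cos ((m + 1/2) θ)`. -/
noncomputable def halfCos (θ : ℝ) (m : ℕ) : ℂ := Complex.cos (((m : ℂ) + 1 / 2) * (θ : ℂ))

theorem norm_halfCos_le (θ : ℝ) (m : ℕ) : ‖halfCos θ m‖ ≤ 1 := by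
  have : halfCos θ m = ((Real.cos (((m : ℝ) + 1 / 2) * θ) : ℝ) : ℂ) := by
    rw [halfCos]; push_cast; rfl
  rw [this, Complex.norm_real]
  exact Real.abs_cos_le_one _

theorem halfCos_zero (θ : ℝ) : halfCos θ 0 = Complex.cos ((θ : ℂ) / 2) := by
  rw [halfCos]; congr 1; push_cast; ring

/-- The recurrence at its lower end, where `c_{-1} = c_0`; this is what pairs `-J_1` with `J_0`. -/
theorem two_mul_cos_mul_halfCos_zero (θ : ℝ) :
    2 * Complex.cos θ * halfCos θ 0 = halfCos θ 1 + halfCos θ 0 := by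
  have h := Complex.cos_add_cos (((1 : ℂ) + 1 / 2) * θ) ((1 / 2 : ℂ) * θ)
  simp only [halfCos, Nat.cast_zero, Nat.cast_one, zero_add, h]
  ring_nf

theorem two_mul_cos_mul_halfCos_succ (θ : ℝ) (m : ℕ) :
    2 * Complex.cos θ * halfCos θ (m + 1) = halfCos θ (m + 2) + halfCos θ m := by
  have h := Complex.cos_add_cos (((m : ℂ) + 2 + 1 / 2) * θ) (((m : ℂ) + 1 / 2) * θ)
  simp only [halfCos, Nat.cast_add, Nat.cast_one, Nat.cast_ofNat, h]
  ring_nf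

theorem hasDerivAt_besselSeriesSum_halfCos (θ : ℝ) (x : ℂ) :
    HasDerivAt (besselSeriesSum (halfCos θ))
      (4 * Complex.cos θ * (x * besselSeriesSum (halfCos θ) x) + 2 * Complex.cos ((θ : ℂ) / 2) *
        (Complex.exp (-2 * x ^ 2) * ((Real.sqrt Real.pi : ℝ) : ℂ)⁻¹)) x := by
  have hc := norm_halfCos_le θ
  convert hasDerivAt_besselSeriesSum hc x using 1
  have h0 := summable_mul_besselSum x hc
  have hF := hasSum_mul_besselSum_succ hc x
  have h1 : Summable fun m => halfCos θ (m + 1) * besselSum x (m + 1) :=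
    (summable_nat_add_iff (f := fun m => halfCos θ m * besselSum x m) 1).mpr h0
  have hF' := (hF.mul_left (2 * Complex.cos θ)).sub h1.hasSum
  have e1 := hF'.summable.tsum_eq_zero_add
  rw [hF'.tsum_eq] at e1
  have e2 : ∀ m : ℕ, 2 * Complex.cos θ * (halfCos θ (m + 1) * besselSum x (m + 1 + 1)) -
      halfCos θ (m + 1 + 1) * besselSum x (m + 1 + 1) = halfCos θ m * besselSum x (m + 2) :=
    fun m => by linear_combination besselSum x (m + 2) * two_mul_cos_mul_halfCos_succ θ m
  simp only [e2, zero_add] at e1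
  have e3 := h0.tsum_eq_zero_add
  have e4 := besselSum_zero_sub_one x
  rw [← halfCos_zero, ← e4]
  linear_combination 2 * e1 - 2 * e3 + 2 * besselSum x 1 * two_mul_cos_mul_halfCos_zero θ

theorem besselSeriesSum_zero (a : ℕ → ℂ) : besselSeriesSum a 0 = 0 := by
  simp [besselSeriesSum, besselSeriesTerm]

theorem hasDerivAt_exp_mul_besselSeriesSum (θ : ℝ) (x : ℂ) :
    HasDerivAt (fun y => Complex.exp (-2 * Complex.cos θ * y ^ 2) * besselSeriesSum (halfCos θ) y)
      (2 * Complex.cos ((θ : ℂ) / 2) * ((Real.sqrt Real.pi : ℝ) : ℂ)⁻¹ *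
        Complex.exp (-(2 * x * Complex.cos ((θ : ℂ) / 2)) ^ 2)) x := by
  have h1 : HasDerivAt (fun y : ℂ => Complex.exp (-2 * Complex.cos θ * y ^ 2)) _ x :=
    ((hasDerivAt_pow 2 x).const_mul (-2 * Complex.cos θ)).cexp
  refine (h1.mul (hasDerivAt_besselSeriesSum_halfCos θ x)).congr_deriv ?_
  have hcos : Complex.cos θ = 2 * Complex.cos ((θ : ℂ) / 2) ^ 2 - 1 := by
    rw [← Complex.cos_two_mul]
    congr 1
    ring
  have hexp : Complex.exp (-(2 * x * Complex.cos ((θ : ℂ) / 2)) ^ 2) =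
      Complex.exp (-2 * Complex.cos θ * x ^ 2) * Complex.exp (-2 * x ^ 2) := by
    rw [← Complex.exp_add, hcos]
    congr 1
    ring
  rw [hexp]
  push_cast
  ring

theorem cerf_two_mul_mul_cos (θ : ℝ) (x : ℂ) : cerf (2 * x * Complex.cos ((θ : ℂ) / 2)) =
    2 * Complex.exp (-2 * Complex.cos θ * x ^ 2) * besselSeriesSum (halfCos θ) x := by
  have hd : ∀ s : ℝ, HasDerivAt (fun s : ℝ =>
      Complex.exp (-2 * Complex.cos θ * (s * x) ^ 2) * besselSeriesSum (halfCos θ) (s * x))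
      (((Real.sqrt Real.pi : ℝ) : ℂ)⁻¹ * (2 * x * Complex.cos ((θ : ℂ) / 2) *
        Complex.exp (-((s : ℂ) * (2 * x * Complex.cos ((θ : ℂ) / 2))) ^ 2))) s := fun s => by
    have h := (hasDerivAt_exp_mul_besselSeriesSum θ (s * x)).comp (s : ℂ)
      ((hasDerivAt_id (s : ℂ)).mul_const x)
    refine h.comp_ofReal.congr_deriv ?_
    rw [show 2 * (s * x) * Complex.cos ((θ : ℂ) / 2) =
      s * (2 * x * Complex.cos ((θ : ℂ) / 2)) by ring]
    ring
  -- Integrating along `s ↦ s x` reproduces the segment integral that defines `cerf`.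
  have hi := intervalIntegral.integral_eq_sub_of_hasDerivAt (a := 0) (b := 1) (fun s _ => hd s)
    (Continuous.intervalIntegrable (by fun_prop) _ _)
  rw [intervalIntegral.integral_const_mul] at hi
  simp only [Complex.ofReal_zero, Complex.ofReal_one, zero_mul, one_mul, besselSeriesSum_zero,
    mul_zero, sub_zero] at hi
  rw [cerf, div_eq_mul_inv, mul_assoc, hi, ← mul_assoc]

/-! ### Return to the two readings of the Bessel function -/

theorem hasSum_pow_mul_besselISeries {a : ℕ → ℂ} (ha : ∀ m, ‖a m‖ ≤ 1) (x : ℂ) :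
    HasSum (fun m : ℕ => x ^ (2 * m + 1) * besselISeries ((m : ℂ) + 1 / 2) (2 * x ^ 2) * a m)
      (besselSeriesSum a x) := by
  have hs := summable_besselSeriesTerm ha x
  refine (hs.hasSum.prod_fiberwise fun m => (hs.prod_factor m).hasSum).congr_fun fun m => ?_
  rw [besselISeries, ← tsum_mul_left, ← tsum_mul_right]
  refine tsum_congr fun k => ?_
  rw [besselSeriesTerm, halfGammaInv, show (m : ℂ) + 1 / 2 + k + 1 =
    ((m + k + 1 : ℕ) : ℂ) + 1 / 2 by push_cast; ring, show (2 * x ^ 2) ^ 2 / 4 = x ^ 4 by ring,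
    ← pow_mul, div_eq_mul_inv, mul_inv]
  ring

theorem besselILift_two_mul_sub_log (m : ℕ) (ω : ℂ) :
    besselILift ((m : ℂ) + 1 / 2) (2 * ω - Complex.log 2) =
      (Complex.exp ω / 2) ^ (2 * m + 1) *
        besselISeries ((m : ℂ) + 1 / 2) (2 * (Complex.exp ω / 2) ^ 2) := by
  have h2 : Complex.exp (Complex.log 2) = 2 := Complex.exp_log two_ne_zero
  have e1 : Complex.exp (2 * ω - Complex.log 2) = 2 * (Complex.exp ω / 2) ^ 2 := by
    rw [Complex.exp_sub, h2, two_mul, Complex.exp_add]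
    ring
  have e2 : Complex.exp ω / 2 = Complex.exp (ω - Complex.log 2) := by rw [Complex.exp_sub, h2]
  rw [besselILift, e1, e2, ← Complex.exp_nat_mul (ω - Complex.log 2) (2 * m + 1)]
  congr 2
  push_cast
  ring

theorem besselI_sq_div_two (m : ℕ) {w : ℂ} (h1 : -(Real.pi / 2) < w.arg)
    (h2 : w.arg ≤ Real.pi / 2) : besselI ((m : ℂ) + 1 / 2) (w ^ 2 / 2) =
      (w / 2) ^ (2 * m + 1) * besselISeries ((m : ℂ) + 1 / 2) (2 * (w / 2) ^ 2) := by
  have harg : (w / 2).arg = w.arg := by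
    rw [show w / 2 = ((1 / 2 : ℝ) : ℂ) * w by push_cast; ring]
    exact Complex.arg_real_mul w (by norm_num)
  -- The bounds on `w.arg` place `2 * arg (w / 2)` in `(-π, π]`, so the principal power of the
  -- square undoes the squaring.
  have hpow : (w ^ 2 / 2 / 2) ^ ((m : ℂ) + 1 / 2) = (w / 2) ^ (2 * m + 1) := by
    rw [show w ^ 2 / 2 / 2 = (w / 2) ^ 2 by ring,
      ← Complex.cpow_nat_mul' (by rw [harg]; push_cast; linarith)
        (by rw [harg]; push_cast; linarith), ← Complex.cpow_natCast]
    congr 1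
    push_cast
    ring
  rw [besselI, hpow]
  congr 2
  ring

theorem summable_and_cerf_eq (w : ℂ) (θ : ℝ) {b : ℕ → ℂ} (hb : ∀ m : ℕ, b m =
      (w / 2) ^ (2 * m + 1) * besselISeries ((m : ℂ) + 1 / 2) (2 * (w / 2) ^ 2)) :
    Summable (fun m : ℕ => b m * Complex.cos (((m : ℂ) + 1 / 2) * (θ : ℂ))) ∧
      cerf (w * Complex.cos ((θ : ℂ) / 2)) =
        2 * Complex.exp (-(1 / 2) * w ^ 2 * Complex.cos (θ : ℂ)) *
          ∑' m : ℕ, b m * Complex.cos (((m : ℂ) + 1 / 2) * (θ : ℂ)) := by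
  have h := hasSum_pow_mul_besselISeries (norm_halfCos_le θ) (w / 2)
  simp only [← hb, halfCos] at h
  refine ⟨h.summable, ?_⟩
  rw [h.tsum_eq]
  convert cerf_two_mul_mul_cos θ (w / 2) using 3
  · ring
  · congr 1
    ring

theorem mainTheorem8 :
    -- principal branches: `w` is the principal square root of `w ^ 2`
    (∀ w : ℂ, -(Real.pi / 2) < w.arg → w.arg ≤ Real.pi / 2 → ∀ θ : ℝ,
      Summable (fun m : ℕ =>
        besselI ((m : ℂ) + 1 / 2) (w ^ 2 / 2) * Complex.cos (((m : ℂ) + 1 / 2) * (θ : ℂ))) ∧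
      cerf (w * Complex.cos ((θ : ℂ) / 2)) =
        2 * Complex.exp (-(1 / 2) * w ^ 2 * Complex.cos (θ : ℂ)) *
          ∑' m : ℕ,
            besselI ((m : ℂ) + 1 / 2) (w ^ 2 / 2) * Complex.cos (((m : ℂ) + 1 / 2) * (θ : ℂ))) ∧
    -- all nonzero `w`: if `ω` is a logarithm of `w`, the logarithm of `w ^ 2 / 2` is `2 ω - log 2`
    (∀ w ω : ℂ, Complex.exp ω = w → ∀ θ : ℝ,
      Summable (fun m : ℕ =>
        besselILift ((m : ℂ) + 1 / 2) (2 * ω - Complex.log 2) *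
          Complex.cos (((m : ℂ) + 1 / 2) * (θ : ℂ))) ∧
      cerf (w * Complex.cos ((θ : ℂ) / 2)) =
        2 * Complex.exp (-(1 / 2) * w ^ 2 * Complex.cos (θ : ℂ)) *
          ∑' m : ℕ,
            besselILift ((m : ℂ) + 1 / 2) (2 * ω - Complex.log 2) *
              Complex.cos (((m : ℂ) + 1 / 2) * (θ : ℂ))) := by
  exact ⟨fun w h1 h2 θ => summable_and_cerf_eq w θ fun m => besselI_sq_div_two m h1 h2,
    fun w ω hω θ => summable_and_cerf_eq w θ fun m => hω ▸ besselILift_two_mul_sub_log m ω⟩
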